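/- Let $Y$ be a path-connected, locally compact Hausdorff space with base point $y_0$. All function spaces carry the compact-open topology. For a based space $Z$, let $\mathrm{aut}_1 Z$ be the space of unbased self-maps of $Z$ freely homotopic to the identity (such maps are automatically homotopy equivalences), based at the identity, and let $\omega\colon \mathrm{aut}_1 Z\to Z$ be evaluation at the base point. For $n\ge 1$ the $n$-th Gottlieb group of $Z$ is $$G_n(Z)=\operatorname{im}\bigl(\omega_\#\colon \pi_n(\mathrm{aut}_1 Z)\to \pi_n(Z)\bigr).$$ For a space $X$ let $\mathrm{map}(X,Z;0)$ be the space of unbased maps $X\to Z$ that are freely homotopic to the constant map at the base point, based at that constant map. For $m\ge 1$ let $S_m=S^1\vee\dots\vee S^1$ be the bouquet of $m$ circles; put $\Lambda_m Z=\mathrm{map}(S_m,Z;0)$, $\Lambda_m^1Y=\Lambda_mY$ and $\Lambda_m^NY=\Lambda_m(\Lambda_m^{N-1}Y)$ for $N\ge 2$ (the $N$-fold iterated free $m$-bouquet space of $Y$). Likewise put $\Lambda Z=\mathrm{map}(S^1,Z;0)$, $\Lambda^1Y=\Lambda Y$ and $\Lambda^NY=\Lambda(\Lambda^{N-1}Y)$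 for $N\ge 2$ (the $N$-fold iterated free loop space). For an abelian group $G$ and an integer $k\ge 0$, write $kG$ for the direct sum of $k$ copies of $G$. Then the groups $G_k(Y)$, $k\ge1$, are abelian, and for all $m,N,n\ge 1$ there is an isomorphism of groups $$G_n(\Lambda_m^N Y)\;\cong\;\bigoplus_{j=0}^{N} m^j\binom{N}{j}\,G_{n+j}(Y).$$ In particular (the case $m=1$), for all $N,n\ge1$, $$G_n(\Lambda^N Y)\;\cong\;\bigoplus_{j=0}^{N}\binom{N}{j}\,G_{n+j}(Y).$$ -/

import Mathlib

open scoped unitInterval Topology Topology.Homotopy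

universe u v

/-- Postcomposition of an `n`-dimensional cubical loop with a continuous map. -/
def genLoopMap {n : ℕ} {X : Type u} {Y : Type v} [TopologicalSpace X] [TopologicalSpace Y]
    (f : C(X, Y)) {x : X} {y : Y} (h : f x = y) (p : GenLoop (Fin n) X x) :
    GenLoop (Fin n) Y y :=
  ⟨f.comp p.1, fun t ht => by
    rw [ContinuousMap.comp_apply, p.2 t ht, h]⟩

theorem genLoopMap_homotopic {n : ℕ} {X : Type u} {Y : Type v} [TopologicalSpace X]
    [TopologicalSpace Y] (f : C(X, Y)) {x : X} {y : Y} (h : f x = y)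
    {p q : GenLoop (Fin n) X x} (H : GenLoop.Homotopic p q) :
    GenLoop.Homotopic (genLoopMap f h p) (genLoopMap f h q) :=
  H.comp_continuousMap f

/-- The map induced on `n`-th homotopy groups (or sets, when `n = 0`) by a continuous map. -/
def homotopyGroupMap {n : ℕ} {X : Type u} {Y : Type v} [TopologicalSpace X]
    [TopologicalSpace Y] (f : C(X, Y)) {x : X} {y : Y} (h : f x = y) :
    HomotopyGroup (Fin n) X x → HomotopyGroup (Fin n) Y y :=
  Quotient.map (genLoopMap f h) fun _ _ H => genLoopMap_homotopic f h H

theorem genLoopMap_transAt {n : ℕ} {X : Type u} {Y : Type v} [TopologicalSpace X]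
    [TopologicalSpace Y] (f : C(X, Y)) {x : X} {y : Y} (h : f x = y) (i : Fin n)
    (p q : GenLoop (Fin n) X x) :
    genLoopMap f h (GenLoop.transAt i p q) =
      GenLoop.transAt i (genLoopMap f h p) (genLoopMap f h q) := by
  ext t
  change f (ite _ _ _) = ite _ _ _
  split_ifs <;> rfl

/-- The homomorphism induced on `n`-th homotopy groups, `n ≥ 1`, by a continuous map. -/
noncomputable def homotopyGroupHom (n : ℕ) [NeZero n] {X : Type u} {Y : Type v} [TopologicalSpace X]
    [TopologicalSpace Y] (f : C(X, Y)) {x : X} {y : Y} (h : f x = y) :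
    HomotopyGroup (Fin n) X x →* HomotopyGroup (Fin n) Y y :=
  MonoidHom.mk' (homotopyGroupMap f h) fun a b => by
    induction a using Quotient.inductionOn with | _ p
    induction b using Quotient.inductionOn with | _ q
    have h1 := HomotopyGroup.mul_spec (i := (0 : Fin n)) (p := p) (q := q)
    have h2 := HomotopyGroup.mul_spec (i := (0 : Fin n)) (p := genLoopMap f h p)
      (q := genLoopMap f h q)
    refine (congrArg (homotopyGroupMap f h) h1).trans (Eq.trans ?_ h2.symm)
    exact congrArg (Quotient.mk _) (genLoopMap_transAt f h 0 q p)

/-- A topological space with a chosen base point. -/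
structure BasedSpace where
  carrier : Type u
  [top : TopologicalSpace carrier]
  point : carrier

namespace BasedSpace

instance : CoeSort BasedSpace.{u} (Type u) := ⟨BasedSpace.carrier⟩

instance (Y : BasedSpace.{u}) : TopologicalSpace Y := Y.top

/-- `aut₁ Y`: the unbased self-maps of `Y` that are freely homotopic to the identity (they are
automatically homotopy equivalences), with the compact-open topology and base point the
identity. -/
def aut₁ (Y : BasedSpace.{u}) : BasedSpace.{u} where
  carrier := {f : C(Y, Y) // f.Homotopic (ContinuousMap.id Y)}
  point := ⟨ContinuousMap.id Y, ContinuousMap.Homotopic.refl _⟩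

/-- The evaluation map `ω : aut₁ Y → Y` at the base point. -/
def omega (Y : BasedSpace.{u}) : C(Y.aut₁, Y) where
  toFun f := f.1 Y.point
  continuous_toFun := (continuous_eval_const Y.point).comp continuous_subtype_val

/-- The `n`-th Gottlieb group `Gₙ(Y)`, `n ≥ 1`: the image of
`ω_# : πₙ(aut₁ Y, id) → πₙ(Y, y₀)`. -/
noncomputable def gottliebGroup (n : ℕ) [NeZero n] (Y : BasedSpace.{u}) :
    Subgroup (HomotopyGroup (Fin n) Y Y.point) :=
  (homotopyGroupHom n Y.omega (x := Y.aut₁.point) rfl).range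

/-- `map(X, Y; 0)`: the unbased maps `X → Y` that are freely homotopic to the constant map at the
base point, with the compact-open topology and base point the constant map. -/
def nullMaps (X : Type) [TopologicalSpace X] (Y : BasedSpace.{u}) : BasedSpace.{u} where
  carrier := {f : C(X, Y) // f.Homotopic (ContinuousMap.const X Y.point)}
  point := ⟨ContinuousMap.const X Y.point, ContinuousMap.Homotopic.refl _⟩

/-- The `N`-fold iterate of `Y ↦ map(X, Y; 0)`. -/
def iterNullMaps (X : Type) [TopologicalSpace X] (Y : BasedSpace.{u}) : ℕ → BasedSpace.{u}
  | 0 => Y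
  | N + 1 => nullMaps X (iterNullMaps X Y N)

end BasedSpace

/-- The relation on `m` disjoint circles identifying all their base points with each other. -/
def bouquetSetoid (m : ℕ) : Setoid (Fin m × Circle) where
  r p q := p = q ∨ (p.2 = 1 ∧ q.2 = 1)
  iseqv :=
    { refl := fun _ => Or.inl rfl
      symm := by
        rintro p q (h | h)
        · exact Or.inl h.symm
        · exact Or.inr ⟨h.2, h.1⟩
      trans := by
        rintro p q r (rfl | h) (rfl | h')
        · exact Or.inl rfl
        · exact Or.inr h'
        · exact Or.inr h
        · exact Or.inr ⟨h.1, h'.2⟩ }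

/-- The bouquet `S¹ ∨ ⋯ ∨ S¹` of `m ≥ 1` circles, with the quotient topology. -/
abbrev Bouquet (m : ℕ) : Type := Quotient (bouquetSetoid m)

namespace BasedSpace

/-- The `N`-fold iterated free `m`-bouquet space of `Y` (`m ≥ 1`). -/
noncomputable def iterFreeBouquet (m N : ℕ) (Y : BasedSpace.{u}) : BasedSpace.{u} :=
  iterNullMaps (Bouquet m) Y N

/-- The `N`-fold iterated free loop space of `Y`. -/
noncomputable def iterFreeLoop (N : ℕ) (Y : BasedSpace.{u}) : BasedSpace.{u} :=
  iterNullMaps Circle Y N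

end BasedSpace

universe w

/-! Let `X` be a bouquet of `m` circles and ω the evaluation map of `aut₁ Y`. Two facts carry the
theorem.

`gottliebGroup_iterNullMaps`: the Gottlieb group of the iterated mapping space is the image on πₙ of
iterated postcomposition with ω. The action of `aut₁ Y` on `Y`, taken pointwise, has that
postcomposition as orbit map, so the image consists of Gottlieb elements. Conversely, a cubical loop
of self-maps of the mapping space, restricted to constant maps, transposes to a cubical loop in the
mapping space of `aut₁ Y` with the same evaluation.

`nonempty_image_postcomp_mulEquiv`: if `M` has a unital multiplication and `f : M → Z` is based,
then on πₙ the image of postcomposition with `f` is the image of πₙ(f) times `m` copies of the image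
of πₙ₊₁(f). The multiplication makes images abelian and factors every class of the source into a
constant part and one part per circle. Independence of the factors is checked in `Z`, which needs no
multiplication.

Composition makes `aut₁ Y` such an `M`, and pointwise multiplication passes this on to mapping
spaces. Iterating gives one factor per cell, and Pascal's rule counts the cells of each degree. -/

instance unitInterval.pathConnectedSpace : PathConnectedSpace I :=
  isPathConnected_iff_pathConnectedSpace.mp
    ((convex_Icc (0 : ℝ) 1).isPathConnected ⟨0, by simp⟩)

/-! ### Families of maps and path components of mapping spaces -/

namespace BasedSpace

/-- A family of maps indexed by a path connected space, one of which is `f₀`, seen as a continuous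
map to the space of maps that are homotopic to `f₀`. -/
def liftFamily {P : Type*} {X : Type*} {Z : Type*} [TopologicalSpace P] [TopologicalSpace X]
    [TopologicalSpace Z] [PathConnectedSpace P] (f₀ : C(X, Z)) (F : C(P × X, Z)) (p₀ : P)
    (h : ∀ x, F (p₀, x) = f₀ x) : C(P, {f : C(X, Z) // f.Homotopic f₀}) where
  toFun p := ⟨F.curry p, by
    obtain ⟨γ⟩ := PathConnectedSpace.joined p p₀
    exact ⟨{ toFun := fun z => F (γ z.1, z.2)
             map_zero_left := by simp
             map_one_left := by simp [h] }⟩⟩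
  continuous_toFun := by
    have := F.curry.continuous
    exact this.subtype_mk _

@[simp] theorem liftFamily_apply {P : Type*} {X : Type*} {Z : Type*} [TopologicalSpace P]
    [TopologicalSpace X] [TopologicalSpace Z] [PathConnectedSpace P] (f₀ : C(X, Z))
    (F : C(P × X, Z)) (p₀ : P) (h : ∀ x, F (p₀, x) = f₀ x) (p : P) (x : X) :
    (liftFamily f₀ F p₀ h p).1 x = F (p, x) := rfl

theorem pathConnectedSpace_homotopic {X : Type*} {Z : Type*} [TopologicalSpace X]
    [TopologicalSpace Z] (f₀ : C(X, Z)) : PathConnectedSpace {f : C(X, Z) // f.Homotopic f₀} := by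
  have key : ∀ f : {f : C(X, Z) // f.Homotopic f₀}, Joined f ⟨f₀, .refl _⟩ := by
    rintro ⟨f, ⟨H⟩⟩
    let F := liftFamily f₀ (P := I) H.toContinuousMap 1 (by simp)
    refine ⟨⟨F, ?_, ?_⟩⟩ <;> (apply Subtype.ext; ext x; simp [F])
  exact ⟨⟨⟨f₀, .refl _⟩⟩, fun f g => (key f).trans (key g).symm⟩

instance (X : Type) [TopologicalSpace X] (Z : BasedSpace.{u}) : PathConnectedSpace (nullMaps X Z) :=
  pathConnectedSpace_homotopic _

instance (Z : BasedSpace.{u}) : PathConnectedSpace Z.aut₁ :=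
  pathConnectedSpace_homotopic _

instance instPathConnectedIter (X : Type) [TopologicalSpace X] (Z : BasedSpace.{u})
    [PathConnectedSpace Z] : ∀ N, PathConnectedSpace (iterNullMaps X Z N)
  | 0 => inferInstanceAs (PathConnectedSpace Z)
  | N + 1 => inferInstanceAs (PathConnectedSpace (nullMaps X (iterNullMaps X Z N)))

section nullMaps

variable {X : Type} [TopologicalSpace X] {Z : BasedSpace.{u}}

/-- Two elements of `map(X, Z; 0)` agree when they agree pointwise. -/
theorem nullMaps_ext {f g : nullMaps X Z} (h : ∀ x, f.1 x = g.1 x) : f = g :=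
  Subtype.ext (ContinuousMap.ext h)

/-- A null family indexed by a path connected space. -/
def nullFamily {P : Type*} [TopologicalSpace P] [PathConnectedSpace P] (F : C(P × X, Z)) (p₀ : P)
    (h : ∀ x, F (p₀, x) = Z.point) : C(P, nullMaps X Z) :=
  liftFamily (ContinuousMap.const X Z.point) F p₀ h

@[simp] theorem nullFamily_apply {P : Type*} [TopologicalSpace P] [PathConnectedSpace P]
    (F : C(P × X, Z)) (p₀ : P) (h : ∀ x, F (p₀, x) = Z.point) (p : P) (x : X) :
    (nullFamily F p₀ h p).1 x = F (p, x) := rfl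

/-- Joint evaluation on `map(X, Z; 0)`. -/
def nullEval [LocallyCompactSpace X] : C(nullMaps X Z × X, Z) where
  toFun z := z.1.1 z.2
  continuous_toFun :=
    continuous_eval.comp ((continuous_subtype_val.comp continuous_fst).prodMk continuous_snd)

end nullMaps

/-! ### Based maps, homotopy classes and unital multiplications -/

/-- Based continuous maps. -/
@[ext]
structure Hom (M : BasedSpace.{u}) (Z : BasedSpace.{v}) where
  toMap : C(M, Z)
  map_point : toMap M.point = Z.point

/-- The class of a cubical loop in the homotopy group. -/
def cls {n : ℕ} {Z : BasedSpace.{u}} (p : GenLoop (Fin n) Z Z.point) :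
    HomotopyGroup (Fin n) Z Z.point :=
  Quotient.mk _ p

theorem cls_eq_iff {n : ℕ} {Z : BasedSpace.{u}} {p q : GenLoop (Fin n) Z Z.point} :
    cls p = cls q ↔ GenLoop.Homotopic p q :=
  Quotient.eq

theorem cls_surjective {n : ℕ} {Z : BasedSpace.{u}} (x : HomotopyGroup (Fin n) Z Z.point) :
    ∃ p, cls p = x :=
  Quotient.exists_rep x

theorem cls_const {n : ℕ} [NeZero n] {Z : BasedSpace.{u}} :
    cls (GenLoop.const : GenLoop (Fin n) Z Z.point) = 1 :=
  HomotopyGroup.one_def.symm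

theorem cls_transAt {n : ℕ} [NeZero n] {Z : BasedSpace.{u}} (i : Fin n)
    (p q : GenLoop (Fin n) Z Z.point) : cls (GenLoop.transAt i q p) = cls p * cls q :=
  HomotopyGroup.mul_spec.symm

namespace Hom

/-- Composition of based maps. -/
def comp {A : BasedSpace.{u}} {B : BasedSpace.{v}} {C : BasedSpace.{w}} (g : Hom B C)
    (f : Hom A B) : Hom A C :=
  ⟨g.toMap.comp f.toMap, by simp [f.map_point, g.map_point]⟩

variable {M Z : BasedSpace.{u}}

/-- The homomorphism induced by a based map on `n`-th homotopy groups. -/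
noncomputable def pi (n : ℕ) [NeZero n] (f : Hom M Z) :
    HomotopyGroup (Fin n) M M.point →* HomotopyGroup (Fin n) Z Z.point :=
  homotopyGroupHom n f.toMap f.map_point

theorem pi_cls (n : ℕ) [NeZero n] (f : Hom M Z) (p : GenLoop (Fin n) M M.point) :
    f.pi n (cls p) = cls (genLoopMap f.toMap f.map_point p) := rfl

theorem pi_comp (n : ℕ) [NeZero n] {A B C : BasedSpace.{u}} (g : Hom B C) (f : Hom A B)
    (x : HomotopyGroup (Fin n) A A.point) : (g.comp f).pi n x = g.pi n (f.pi n x) := by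
  induction x using Quotient.inductionOn
  rfl

/-- The image of a based map on `n`-th homotopy groups. -/
noncomputable def image (n : ℕ) [NeZero n] (f : Hom M Z) :
    Subgroup (HomotopyGroup (Fin n) Z Z.point) :=
  (f.pi n).range

/-- Postcomposition with a based map. -/
def postcomp (X : Type) [TopologicalSpace X] [LocallyCompactSpace X] (f : Hom M Z) :
    Hom (nullMaps X M) (nullMaps X Z) where
  toMap := nullFamily (f.toMap.comp nullEval) (nullMaps X M).point fun _ => f.map_point
  map_point := nullMaps_ext fun _ => f.map_point

/-- The `N`-fold iterate of postcomposition with a based map. -/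
def iter (X : Type) [TopologicalSpace X] [LocallyCompactSpace X] (f : Hom M Z) :
    ∀ N, Hom (iterNullMaps X M N) (iterNullMaps X Z N)
  | 0 => f
  | N + 1 => (iter X f N).postcomp X

end Hom

/-- The evaluation map as a based map. -/
def omegaHom (Y : BasedSpace.{u}) : Hom Y.aut₁ Y := ⟨Y.omega, rfl⟩

/-- A continuous multiplication for which the base point is a strict unit. -/
structure UnitalMul (M : BasedSpace.{u}) where
  mul : C(M × M, M)
  point_mul : ∀ a, mul (M.point, a) = a
  mul_point : ∀ a, mul (a, M.point) = a

namespace UnitalMul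

variable {M : BasedSpace.{u}}

/-- The pointwise multiplication of null maps. -/
def pointwise (X : Type) [TopologicalSpace X] [LocallyCompactSpace X] (μ : UnitalMul M) :
    UnitalMul (nullMaps X M) where
  mul := nullFamily
    (P := nullMaps X M × nullMaps X M)
    ⟨fun z => μ.mul (nullEval (z.1.1, z.2), nullEval (z.1.2, z.2)), by fun_prop⟩
    ((nullMaps X M).point, (nullMaps X M).point) fun _ => μ.point_mul _
  point_mul a := nullMaps_ext fun _ => μ.point_mul _
  mul_point a := nullMaps_ext fun _ => μ.mul_point _

/-- The iterated pointwise multiplication. -/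
def iter (X : Type) [TopologicalSpace X] [LocallyCompactSpace X] (μ : UnitalMul M) :
    ∀ N, UnitalMul (iterNullMaps X M N)
  | 0 => μ
  | N + 1 => (iter X μ N).pointwise X

/-- Composition of self-maps. -/
def aut₁ (Y : BasedSpace.{u}) [LocallyCompactSpace Y] : UnitalMul Y.aut₁ where
  mul := liftFamily (P := Y.aut₁ × Y.aut₁) (ContinuousMap.id Y)
    ⟨fun z => z.1.1.1 (z.1.2.1 z.2), by
      have h : Continuous fun z : Y.aut₁ × Y => z.1.1 z.2 :=
        continuous_eval.comp ((continuous_subtype_val.comp continuous_fst).prodMk continuous_snd)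
      exact h.comp ((continuous_fst.comp continuous_fst).prodMk
        (h.comp ((continuous_snd.comp continuous_fst).prodMk continuous_snd)))⟩
    (Y.aut₁.point, Y.aut₁.point) fun _ => rfl
  point_mul a := Subtype.ext (ContinuousMap.ext fun _ => rfl)
  mul_point a := Subtype.ext (ContinuousMap.ext fun _ => rfl)

/-- The pointwise product of cubical loops. -/
def mulLoop {n : ℕ} (μ : UnitalMul M) (p q : GenLoop (Fin n) M M.point) :
    GenLoop (Fin n) M M.point :=
  ⟨μ.mul.comp (p.1.prodMk q.1), fun t ht => by
    change μ.mul (p.1 t, q.1 t) = _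
    rw [p.2 t ht, q.2 t ht, μ.mul_point]⟩

theorem mulLoop_homotopic {n : ℕ} (μ : UnitalMul M) {p p' q q' : GenLoop (Fin n) M M.point}
    (hp : GenLoop.Homotopic p p') (hq : GenLoop.Homotopic q q') :
    GenLoop.Homotopic (μ.mulLoop p q) (μ.mulLoop p' q') := by
  obtain ⟨H⟩ := hp
  obtain ⟨K⟩ := hq
  refine ⟨⟨⟨⟨fun z => μ.mul (H z, K z), by fun_prop⟩, fun s => ?_, fun s => ?_⟩, fun t s hs => ?_⟩⟩
  · simp [mulLoop]
  · simp [mulLoop]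
  · have h1 := H.eq_fst t hs
    have h2 := K.eq_fst t hs
    change μ.mul (H (t, s), K (t, s)) = μ.mul (p.1 s, q.1 s)
    rw [h1, h2]

/-- Eckmann–Hilton: pointwise product and concatenation satisfy the interchange law on the nose and
share the unit. This covers n = 1, where commutativity is not automatic. -/
theorem cls_mulLoop_and_mul_comm {n : ℕ} [NeZero n] (μ : UnitalMul M) :
    (∀ p q : GenLoop (Fin n) M M.point, cls (μ.mulLoop p q) = cls p * cls q) ∧
    ∀ x y : HomotopyGroup (Fin n) M M.point, x * y = y * x := by
  let op : HomotopyGroup (Fin n) M M.point → HomotopyGroup (Fin n) M M.point →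
      HomotopyGroup (Fin n) M M.point :=
    Quotient.map₂ μ.mulLoop fun _ _ h _ _ h' => μ.mulLoop_homotopic h h'
  have hop : ∀ p q, op (cls p) (cls q) = cls (μ.mulLoop p q) := fun _ _ => rfl
  have h1 : EckmannHilton.IsUnital op 1 := by
    rw [← cls_const]
    refine { left_id := fun a => ?_, right_id := fun a => ?_ }
    · obtain ⟨a, rfl⟩ := cls_surjective a
      exact congrArg cls (GenLoop.ext _ _ fun s => μ.point_mul _)
    · obtain ⟨a, rfl⟩ := cls_surjective a
      exact congrArg cls (GenLoop.ext _ _ fun s => μ.mul_point _)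
  have h2 : EckmannHilton.IsUnital
      (fun x y : HomotopyGroup (Fin n) M M.point => x * y) 1 :=
    { left_id := one_mul, right_id := mul_one }
  have hd : ∀ a b c d : HomotopyGroup (Fin n) M M.point,
      op (a * b) (c * d) = op a c * op b d := by
    intro a b c d
    obtain ⟨a, rfl⟩ := cls_surjective a
    obtain ⟨b, rfl⟩ := cls_surjective b
    obtain ⟨c, rfl⟩ := cls_surjective c
    obtain ⟨d, rfl⟩ := cls_surjective d
    rw [← cls_transAt 0, ← cls_transAt 0, hop, hop, hop, ← cls_transAt 0]
    refine congrArg cls (GenLoop.ext _ _ fun s => ?_)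
    change μ.mul (ite _ _ _, ite _ _ _) = ite _ _ _
    split_ifs <;> rfl
  have key := EckmannHilton.mul h1 h2 hd
  exact ⟨fun p q => congrFun (congrFun key (cls p)) (cls q),
    (EckmannHilton.mul_comm h1 h2 hd).comm⟩

theorem cls_mulLoop {n : ℕ} [NeZero n] (μ : UnitalMul M) (p q : GenLoop (Fin n) M M.point) :
    cls (μ.mulLoop p q) = cls p * cls q :=
  μ.cls_mulLoop_and_mul_comm.1 p q

theorem image_mul_comm {n : ℕ} [NeZero n] (μ : UnitalMul M) {Z : BasedSpace.{u}} (f : Hom M Z)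
    (a b : f.image n) : a * b = b * a := by
  obtain ⟨_, x, rfl⟩ := a
  obtain ⟨_, y, rfl⟩ := b
  refine Subtype.ext ?_
  change f.pi n x * f.pi n y = f.pi n y * f.pi n x
  rw [← map_mul, ← map_mul, μ.cls_mulLoop_and_mul_comm.2 x y]

end UnitalMul

end BasedSpace

/-! ### Gottlieb groups of iterated mapping spaces as images -/

namespace BasedSpace

/-- An action, up to the evident unit laws, of `M` on `Z` whose orbit map at the base point
is `f`. -/
structure OrbitAction {M Z : BasedSpace.{u}} (f : Hom M Z) where
  act : C(M × Z, Z)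
  point_act : ∀ z, act (M.point, z) = z
  act_point : ∀ m, act (m, Z.point) = f.toMap m

namespace OrbitAction

variable {M Z : BasedSpace.{u}} {f : Hom M Z}

/-- The pointwise action on null maps. -/
def pointwise (X : Type) [TopologicalSpace X] [LocallyCompactSpace X] (a : OrbitAction f) :
    OrbitAction (f.postcomp X) where
  act := nullFamily (P := nullMaps X M × nullMaps X Z)
    ⟨fun z => a.act (nullEval (z.1.1, z.2), nullEval (z.1.2, z.2)), by fun_prop⟩
    ((nullMaps X M).point, (nullMaps X Z).point) fun _ => a.point_act _
  point_act _ := nullMaps_ext fun _ => a.point_act _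
  act_point _ := nullMaps_ext fun _ => a.act_point _

/-- The iterated pointwise action. -/
def iter (X : Type) [TopologicalSpace X] [LocallyCompactSpace X] (a : OrbitAction f) :
    ∀ N, OrbitAction (f.iter X N)
  | 0 => a
  | N + 1 => (iter X a N).pointwise X

/-- The tautological action of `aut₁ Y` on `Y`. -/
def aut₁ (Y : BasedSpace.{u}) [LocallyCompactSpace Y] : OrbitAction Y.omegaHom where
  act := ⟨fun z => z.1.1 z.2,
    continuous_eval.comp ((continuous_subtype_val.comp continuous_fst).prodMk continuous_snd)⟩
  point_act _ := rfl
  act_point _ := rfl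

/-- An orbit map of an action of a path connected space factors through the evaluation map. -/
theorem image_le [PathConnectedSpace M] (a : OrbitAction f) (n : ℕ) [NeZero n] :
    f.image n ≤ Z.gottliebGroup n := by
  -- The adjoint of the action lands in `aut₁ Z` because `M` is path connected and its base point
  -- acts as the identity.
  let τ : Hom M Z.aut₁ :=
    ⟨liftFamily (ContinuousMap.id Z) a.act M.point a.point_act,
      Subtype.ext (ContinuousMap.ext a.point_act)⟩
  have hτ : Z.omegaHom.comp τ = f := Hom.ext (ContinuousMap.ext a.act_point)
  rintro _ ⟨x, rfl⟩
  refine ⟨τ.pi n x, ?_⟩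
  change Z.omegaHom.pi n _ = _
  rw [← Hom.pi_comp, hτ]

end OrbitAction

section constants

variable (X : Type) [TopologicalSpace X]

/-- The embedding of a path connected space by constant maps. -/
def constHom (Z : BasedSpace.{u}) [PathConnectedSpace Z] : Hom Z (nullMaps X Z) where
  toMap := nullFamily ⟨Prod.fst, continuous_fst⟩ Z.point fun _ => rfl
  map_point := rfl

/-- The embedding of a path connected space in its iterated mapping space by constant maps. -/
def iterConst (Y : BasedSpace.{u}) [PathConnectedSpace Y] : ∀ N, Hom Y (iterNullMaps X Y N)
  | 0 => ⟨ContinuousMap.id Y, rfl⟩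
  | N + 1 => (constHom X (iterNullMaps X Y N)).comp (iterConst Y N)

/-- A family of maps from `Y` to its iterated mapping space, one of which consists of constants,
is transposed to a family in the iterated mapping space of `aut₁ Y`. -/
theorem exists_iter_transpose [LocallyCompactSpace X] [PathConnectedSpace X] (Y : BasedSpace.{u})
    [PathConnectedSpace Y] (N : ℕ) :
    ∀ {P : Type} [TopologicalSpace P] [PathConnectedSpace P]
    (F : C(P × Y, iterNullMaps X Y N)) (p₀ : P)
    (_ : ∀ y, F (p₀, y) = (iterConst X Y N).toMap y),
    ∃ B : C(P, iterNullMaps X Y.aut₁ N),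
      (∀ p, (Y.omegaHom.iter X N).toMap (B p) = F (p, Y.point)) ∧
      ∀ p, (∀ y, F (p, y) = (iterConst X Y N).toMap y) →
        B p = (iterNullMaps X Y.aut₁ N).point := by
  induction N with
  | zero =>
    intro P _ _ F p₀ h
    exact ⟨liftFamily (ContinuousMap.id Y) F p₀ h, fun p => rfl,
      fun p hp => Subtype.ext (ContinuousMap.ext hp)⟩
  | succ N ih =>
    intro P _ _ F p₀ h
    obtain ⟨x₀⟩ : Nonempty X := inferInstance
    -- One mapping space is traded for a larger parameter space `P × X`; this is why `P` varies in
    -- the induction.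
    let F' : C((P × X) × Y, iterNullMaps X Y N) :=
      ⟨fun z => nullEval (X := X) (Z := iterNullMaps X Y N) (F (z.1.1, z.2), z.1.2), by
        exact nullEval.continuous.comp
          ((F.continuous.comp ((continuous_fst.comp continuous_fst).prodMk continuous_snd)).prodMk
            (continuous_snd.comp continuous_fst))⟩
    have hF' : ∀ p x, (∀ y, F (p, y) = (iterConst X Y (N + 1)).toMap y) →
        ∀ y, F' ((p, x), y) = (iterConst X Y N).toMap y := by
      intro p x hp y
      change (F (p, y)).1 x = _
      rw [hp y]
      rfl
    obtain ⟨B, h1, h2⟩ := ih F' (p₀, x₀) (hF' p₀ x₀ h)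
    -- The second clause of the induction hypothesis makes `B (p₀, x)` the base point for every `x`,
    -- so the maps `B (p, ·)` are null.
    refine ⟨nullFamily B p₀ ?_, ?_, ?_⟩
    · exact fun x => h2 _ (hF' p₀ x h)
    · exact fun p => nullMaps_ext fun x => h1 (p, x)
    · exact fun p hp => nullMaps_ext fun x => h2 _ (hF' p x hp)

/-- The Gottlieb group of an iterated mapping space is the image of the iterated mapping space of
the evaluation map. -/
theorem gottliebGroup_iterNullMaps [LocallyCompactSpace X] [PathConnectedSpace X]
    (Y : BasedSpace.{u}) [PathConnectedSpace Y] [LocallyCompactSpace Y] (N n : ℕ) [NeZero n] :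
    (iterNullMaps X Y N).gottliebGroup n = (Y.omegaHom.iter X N).image n := by
  refine le_antisymm ?_ (((OrbitAction.aut₁ Y).iter X N).image_le n)
  rintro _ ⟨x, rfl⟩
  obtain ⟨A, rfl⟩ := cls_surjective x
  -- The self-maps `A s` are restricted to the copy of `Y` formed by the constant maps.
  let F : C((Fin n → I) × Y, iterNullMaps X Y N) :=
    ⟨fun z => (A.1 z.1).1 ((iterConst X Y N).toMap z.2), by
      have h : Continuous fun s : (Fin n → I) =>
          (A.1 s).1.comp (iterConst X Y N).toMap :=
        (ContinuousMap.continuous_precomp _).comp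
          (continuous_subtype_val.comp A.1.continuous)
      exact continuous_eval.comp ((h.comp continuous_fst).prodMk continuous_snd)⟩
  have hF : ∀ s ∈ Cube.boundary (Fin n), ∀ y, F (s, y) = (iterConst X Y N).toMap y := by
    intro s hs y
    change (A.1 s).1 _ = _
    rw [A.2 s hs]
    rfl
  -- Since n ≥ 1, the corner 0 lies on the boundary of the cube, where `A` is the identity.
  obtain ⟨B, h1, h2⟩ := exists_iter_transpose X Y N F 0 (hF 0 ⟨0, Or.inl rfl⟩)
  refine ⟨cls ⟨B, fun s hs => h2 _ (hF s hs)⟩, ?_⟩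
  refine congrArg cls (GenLoop.ext _ _ fun s => ?_)
  refine (h1 s).trans ?_
  change (A.1 s).1 ((iterConst X Y N).toMap Y.point) = (A.1 s).1 (iterNullMaps X Y N).point
  rw [(iterConst X Y N).map_point]

end constants

end BasedSpace

/-! ### Bouquets glued from arcs, and maps out of them -/

/-- A presentation of a space as a bouquet of `m` circles, each given as the image of an arc with
identified ends. -/
structure ArcPresentation (m : ℕ) (X : Type) [TopologicalSpace X] where
  base : X
  arc : Fin m → C(I, X)
  arc_zero : ∀ k, arc k 0 = base
  arc_one : ∀ k, arc k 1 = base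
  exists_arc : ∀ x, ∃ k t, arc k t = x
  arc_eq : ∀ k t l u, arc k t = arc l u →
    (k = l ∧ t = u) ∨ ((t = 0 ∨ t = 1) ∧ (u = 0 ∨ u = 1))

namespace ArcPresentation

variable {m : ℕ} {X : Type} [TopologicalSpace X] (A : ArcPresentation m X)

theorem arc_of_end (k : Fin m) {t : I} (ht : t = 0 ∨ t = 1) : A.arc k t = A.base := by
  rcases ht with rfl | rfl
  · exact A.arc_zero k
  · exact A.arc_one k

/-- All arcs together. -/
def arcs : C(Fin m × I, X) :=
  ⟨fun z => A.arc z.1 z.2, continuous_prod_of_discrete_left.2 fun k => (A.arc k).continuous⟩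

theorem isQuotientMap_arcs [T2Space X] : Topology.IsQuotientMap A.arcs :=
  A.arcs.continuous.isClosedMap.isQuotientMap A.arcs.continuous fun x => by
    obtain ⟨k, t, h⟩ := A.exists_arc x
    exact ⟨(k, t), h⟩

/-- Distinct names of one point are both arc ends, where all the `G k` take the common value `b p`.
This makes the choices in `descend` harmless. -/
theorem eq_of_arc_eq {Q Z : Type*} (G : Fin m → Q × I → Z) (b : Q → Z)
    (h : ∀ k p t, t = 0 ∨ t = 1 → G k (p, t) = b p) {k l : Fin m} {t u : I} (p : Q)
    (e : A.arc k t = A.arc l u) : G k (p, t) = G l (p, u) := by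
  rcases A.arc_eq k t l u e with ⟨rfl, rfl⟩ | ⟨h1, h2⟩
  · rfl
  · rw [h k p t h1, h l p u h2]

section descend

variable {Q Z : Type*} [TopologicalSpace Q] [TopologicalSpace Z] [LocallyCompactSpace Q]
  [T2Space X] (G : Fin m → C(Q × I, Z)) (b : Q → Z)
  (h : ∀ k p t, t = 0 ∨ t = 1 → G k (p, t) = b p)

/-- A map out of a bouquet, with parameters, defined on each arc. -/
noncomputable def descend : C(Q × X, Z) where
  toFun z := G (A.exists_arc z.2).choose (z.1, (A.exists_arc z.2).choose_spec.choose)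
  continuous_toFun := by
    -- A product of a quotient map with the locally compact space `Q` is again a quotient map.
    refine A.isQuotientMap_arcs.continuous_lift_prod_right ?_
    have e : (fun z : Q × (Fin m × I) => G (A.exists_arc (A.arcs z.2)).choose
        (z.1, (A.exists_arc (A.arcs z.2)).choose_spec.choose)) =
        fun z => G z.2.1 (z.1, z.2.2) := funext fun z =>
      A.eq_of_arc_eq (fun k => G k) b h _ (A.exists_arc (A.arcs z.2)).choose_spec.choose_spec
    rw [e]
    have h2 : Continuous fun z : Fin m × (Q × I) => G z.1 z.2 :=
      continuous_prod_of_discrete_left.2 fun k => (G k).continuous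
    exact h2.comp (by fun_prop : Continuous fun z : Q × (Fin m × I) => (z.2.1, (z.1, z.2.2)))

@[simp] theorem descend_arc (p : Q) (k : Fin m) (t : I) :
    A.descend G b h (p, A.arc k t) = G k (p, t) :=
  A.eq_of_arc_eq (fun k => G k) b h _ (A.exists_arc (A.arc k t)).choose_spec.choose_spec

end descend

end ArcPresentation

theorem Cube.snoc_mem_boundary {n : ℕ} {s : Fin n → I} {t : I}
    (h : s ∈ Cube.boundary (Fin n) ∨ (t = 0 ∨ t = 1)) :
    (Fin.snoc s t : Fin (n + 1) → I) ∈ Cube.boundary (Fin (n + 1)) := by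
  rcases h with ⟨i, hi⟩ | h
  · exact ⟨i.castSucc, by simpa using hi⟩
  · exact ⟨Fin.last n, by simpa using h⟩

theorem Cube.boundary_succ {n : ℕ} {w : Fin (n + 1) → I} (h : w ∈ Cube.boundary (Fin (n + 1))) :
    Fin.init w ∈ Cube.boundary (Fin n) ∨ (w (Fin.last n) = 0 ∨ w (Fin.last n) = 1) := by
  obtain ⟨i, hi⟩ := h
  induction i using Fin.lastCases with
  | last => exact Or.inr hi
  | cast i => exact Or.inl ⟨i, hi⟩

/-! ### Classes carried by a single circle -/

namespace BasedSpace

section loops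

variable {m : ℕ} {X : Type} [TopologicalSpace X] (A : ArcPresentation m X)
  {Z : BasedSpace.{u}} {n : ℕ} [NeZero n]

theorem nullMaps_ext_arc {f g : nullMaps X Z} (h : ∀ k t, f.1 (A.arc k t) = g.1 (A.arc k t)) :
    f = g :=
  nullMaps_ext fun x => by
    obtain ⟨k, t, rfl⟩ := A.exists_arc x
    exact h k t

variable [T2Space X]

/-- A cubical loop of null maps on a bouquet defined on each arc. -/
noncomputable def loopOfArcs (G : Fin m → C((Fin n → I) × I, Z))
    (h : ∀ k s t, t = 0 ∨ t = 1 → G k (s, t) = Z.point)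
    (hb : ∀ k s t, s ∈ Cube.boundary (Fin n) → G k (s, t) = Z.point) :
    GenLoop (Fin n) (nullMaps X Z) (nullMaps X Z).point :=
  ⟨nullFamily (A.descend G (fun _ => Z.point) h) 0 (fun x => by
      obtain ⟨k, t, rfl⟩ := A.exists_arc x
      rw [A.descend_arc]
      exact hb _ _ _ ⟨0, Or.inl rfl⟩),
    fun s hs => nullMaps_ext_arc A fun k t => by
      rw [nullFamily_apply, A.descend_arc]
      exact hb _ _ _ hs⟩

@[simp] theorem loopOfArcs_apply (G : Fin m → C((Fin n → I) × I, Z))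
    (h : ∀ k s t, t = 0 ∨ t = 1 → G k (s, t) = Z.point)
    (hb : ∀ k s t, s ∈ Cube.boundary (Fin n) → G k (s, t) = Z.point) (s : Fin n → I)
    (k : Fin m) (t : I) : (loopOfArcs A G h hb s).1 (A.arc k t) = G k (s, t) :=
  A.descend_arc G _ h s k t

/-- The value `b` at the wedge point may vary with time and with the cube coordinate, since maps in
`nullMaps X Z` are unbased. -/
theorem homotopic_of_arcs (p q : GenLoop (Fin n) (nullMaps X Z) (nullMaps X Z).point)
    (K : Fin m → C((I × (Fin n → I)) × I, Z)) (b : I × (Fin n → I) → Z)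
    (h : ∀ k s t, t = 0 ∨ t = 1 → K k (s, t) = b s)
    (hp : ∀ k s t, K k ((0, s), t) = (p s).1 (A.arc k t))
    (hq : ∀ k s t, K k ((1, s), t) = (q s).1 (A.arc k t))
    (hb : ∀ k r s t, s ∈ Cube.boundary (Fin n) → K k ((r, s), t) = Z.point) :
    GenLoop.Homotopic p q := by
  have h0 : (0 : Fin n → I) ∈ Cube.boundary (Fin n) := ⟨0, Or.inl rfl⟩
  let F := nullFamily (A.descend K b h) (0, 0) (fun x => by
    obtain ⟨k, t, rfl⟩ := A.exists_arc x
    rw [A.descend_arc]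
    exact hb _ _ _ _ h0)
  have hF : ∀ r k t, (F r).1 (A.arc k t) = K k (r, t) := fun r k t => by
    rw [nullFamily_apply, A.descend_arc]
  refine ⟨⟨⟨F, fun s => ?_, fun s => ?_⟩, fun r s hs => ?_⟩⟩
  · exact nullMaps_ext_arc A fun k t => (hF _ _ _).trans (hp _ _ _)
  · exact nullMaps_ext_arc A fun k t => (hF _ _ _).trans (hq _ _ _)
  · refine nullMaps_ext_arc A fun k t => (hF _ _ _).trans ((hb _ _ _ _ hs).trans ?_)
    rw [p.2 s hs]
    rfl

/-- Appending a coordinate to a cube. -/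
def cubeSnoc (n : ℕ) : C((Fin n → I) × I, Fin (n + 1) → I) :=
  ⟨fun z => Fin.snoc z.1 z.2,
    Continuous.finSnoc (A := fun _ => I) continuous_fst continuous_snd⟩

/-- The loop of null maps which is a given higher loop on the `k`-th circle. -/
noncomputable def circleLoop (k : Fin m) (p : GenLoop (Fin (n + 1)) Z Z.point) :
    GenLoop (Fin n) (nullMaps X Z) (nullMaps X Z).point :=
  loopOfArcs A (fun l => if l = k then p.1.comp (cubeSnoc n) else ContinuousMap.const _ Z.point)
    (fun l s t ht => by
      split_ifs
      · exact p.2 _ (Cube.snoc_mem_boundary (Or.inr ht))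
      · rfl)
    (fun l s t hs => by
      split_ifs
      · exact p.2 _ (Cube.snoc_mem_boundary (Or.inl hs))
      · rfl)

theorem circleLoop_apply (k : Fin m) (p : GenLoop (Fin (n + 1)) Z Z.point) (s : Fin n → I)
    (l : Fin m) (t : I) : (circleLoop A k p s).1 (A.arc l t) =
      if l = k then p (Fin.snoc s t : Fin (n + 1) → I) else Z.point := by
  rw [circleLoop, loopOfArcs_apply]
  split_ifs <;> rfl

theorem circleLoop_homotopic (k : Fin m) {p q : GenLoop (Fin (n + 1)) Z Z.point}
    (H : GenLoop.Homotopic p q) : GenLoop.Homotopic (circleLoop A k p) (circleLoop A k q) := by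
  obtain ⟨H⟩ := H
  have hH : ∀ r w, w ∈ Cube.boundary (Fin (n + 1)) → H (r, w) = Z.point := fun r w hw =>
    (H.eq_fst r hw).trans (p.2 w hw)
  refine homotopic_of_arcs A _ _
    (fun l => if l = k then ⟨fun z => H (z.1.1, cubeSnoc n (z.1.2, z.2)), by fun_prop⟩
      else ContinuousMap.const _ Z.point) (fun _ => Z.point) ?_ ?_ ?_ ?_
  · intro l s t ht
    split_ifs
    · exact hH _ _ (Cube.snoc_mem_boundary (Or.inr ht))
    · rfl
  · intro l s t
    rw [circleLoop_apply]
    split_ifs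
    · exact H.apply_zero _
    · rfl
  · intro l s t
    rw [circleLoop_apply]
    split_ifs
    · exact H.apply_one _
    · rfl
  · intro l r s t hs
    split_ifs
    · exact hH _ _ (Cube.snoc_mem_boundary (Or.inl hs))
    · rfl

/-- The circle coordinate is the last one, so concatenation in an earlier coordinate commutes with
the construction strictly. -/
theorem circleLoop_transAt (k : Fin m) (i : Fin n) (p q : GenLoop (Fin (n + 1)) Z Z.point) :
    circleLoop A k (GenLoop.transAt i.castSucc p q) =
      GenLoop.transAt i (circleLoop A k p) (circleLoop A k q) := by
  refine GenLoop.ext _ _ fun s => nullMaps_ext_arc A fun l t => ?_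
  rw [circleLoop_apply]
  change _ = (ite _ _ _ : nullMaps X Z).1 _
  rw [apply_ite (fun f : nullMaps X Z => f.1 (A.arc l t)), circleLoop_apply, circleLoop_apply]
  split_ifs with h1 h2 h2
  · change ite _ _ _ = _
    rw [Fin.snoc_castSucc, if_pos h2, Fin.snoc_update]
  · change ite _ _ _ = _
    rw [Fin.snoc_castSucc, if_neg h2, Fin.snoc_update]
  · rfl
  · rfl

/-- The homomorphism `π_{n+1}(Z) → π_n(map(X, Z; 0))` given by the `k`-th circle of the
bouquet `X`. -/
noncomputable def circleHom (k : Fin m) : HomotopyGroup (Fin (n + 1)) Z Z.point →*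
    HomotopyGroup (Fin n) (nullMaps X Z) (nullMaps X Z).point :=
  MonoidHom.mk' (Quotient.map (circleLoop A k) fun _ _ H => circleLoop_homotopic A k H)
    fun a b => by
      obtain ⟨p, rfl⟩ := cls_surjective a
      obtain ⟨q, rfl⟩ := cls_surjective b
      rw [← cls_transAt (Fin.castSucc 0)]
      refine (congrArg cls (circleLoop_transAt A k 0 q p)).trans ?_
      exact cls_transAt _ _ _

theorem circleHom_cls (k : Fin m) (p : GenLoop (Fin (n + 1)) Z Z.point) :
    circleHom A k (cls p) = cls (circleLoop A k p) := rfl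

end loops

end BasedSpace

/-! ### Detecting the summands: evaluation, collapse and injectivity -/

namespace ArcPresentation

variable {m : ℕ} {X : Type} [TopologicalSpace X] [T2Space X] (A : ArcPresentation m X)

/-- The self-map of a bouquet that is the identity on the `k`-th circle and collapses the other
circles. -/
noncomputable def collapse (k : Fin m) : C(X, X) :=
  (A.descend (Q := Unit) (Z := X) (fun l => if l = k then (A.arc k).comp ContinuousMap.snd
    else ContinuousMap.const (Unit × I) A.base) (fun _ => A.base) (fun l p t ht => by
      split_ifs
      · exact A.arc_of_end k ht
      · rfl)).curry ()

theorem collapse_arc (k l : Fin m) (t : I) :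
    A.collapse k (A.arc l t) = if l = k then A.arc k t else A.base := by
  rw [collapse, ContinuousMap.curry_apply, A.descend_arc]
  split_ifs <;> rfl

end ArcPresentation

namespace BasedSpace

variable {m : ℕ} {X : Type} [TopologicalSpace X]
  (A : ArcPresentation m X) {M Z : BasedSpace.{u}} {n : ℕ} [NeZero n]

/-- Evaluation of null maps at a point. -/
def evalHom (x : X) : Hom (nullMaps X Z) Z where
  toMap := ⟨fun f => f.1 x, (continuous_eval_const x).comp continuous_subtype_val⟩
  map_point := rfl

theorem pi_evalHom_constHom [PathConnectedSpace Z] (x : X)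
    (a : HomotopyGroup (Fin n) Z Z.point) :
    (evalHom x).pi n ((constHom X Z).pi n a) = a := by
  obtain ⟨p, rfl⟩ := cls_surjective a
  rfl

theorem pi_evalHom_circleHom [T2Space X] (k : Fin m) (a : HomotopyGroup (Fin (n + 1)) Z Z.point) :
    (evalHom A.base).pi n (circleHom A k a) = 1 := by
  obtain ⟨p, rfl⟩ := cls_surjective a
  rw [circleHom_cls, Hom.pi_cls, ← cls_const]
  refine congrArg cls (GenLoop.ext _ _ fun s => ?_)
  change (circleLoop A k p s).1 A.base = Z.point
  rw [← A.arc_zero k, circleLoop_apply, if_pos rfl]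
  exact p.2 _ (Cube.snoc_mem_boundary (Or.inr (Or.inl rfl)))

variable [LocallyCompactSpace X]

/-- Precomposition of null maps with a self-map of the source. -/
def precompHom (k : C(X, X)) : Hom (nullMaps X Z) (nullMaps X Z) where
  toMap := nullFamily ⟨fun z => nullEval (z.1, k z.2), by fun_prop⟩ (nullMaps X Z).point
    fun _ => rfl
  map_point := rfl

theorem pi_postcomp_constHom [PathConnectedSpace M] [PathConnectedSpace Z] (f : Hom M Z)
    (a : HomotopyGroup (Fin n) M M.point) :
    (f.postcomp X).pi n ((constHom X M).pi n a) = (constHom X Z).pi n (f.pi n a) := by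
  obtain ⟨p, rfl⟩ := cls_surjective a
  rfl

variable [T2Space X]

theorem pi_precompHom_circleHom (k l : Fin m) (a : HomotopyGroup (Fin (n + 1)) Z Z.point) :
    (precompHom (A.collapse k)).pi n (circleHom A l a) = if l = k then circleHom A k a else 1 := by
  obtain ⟨p, rfl⟩ := cls_surjective a
  rw [circleHom_cls, circleHom_cls, Hom.pi_cls]
  have hb : ∀ s, (circleLoop A l p s).1 A.base = Z.point := fun s => by
    rw [← A.arc_zero l, circleLoop_apply, if_pos rfl]
    exact p.2 _ (Cube.snoc_mem_boundary (Or.inr (Or.inl rfl)))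
  split_ifs with hlk
  · subst hlk
    refine congrArg cls (GenLoop.ext _ _ fun s => nullMaps_ext_arc A fun j t => ?_)
    change (circleLoop A l p s).1 (A.collapse l (A.arc j t)) = _
    rw [A.collapse_arc]
    by_cases hj : j = l
    · rw [if_pos hj, hj]
    · rw [if_neg hj, hb, circleLoop_apply, if_neg hj]
  · rw [← cls_const]
    refine congrArg cls (GenLoop.ext _ _ fun s => nullMaps_ext_arc A fun j t => ?_)
    change (circleLoop A l p s).1 (A.collapse k (A.arc j t)) = Z.point
    rw [A.collapse_arc]
    by_cases hj : j = k
    · rw [if_pos hj, circleLoop_apply, if_neg (Ne.symm hlk)]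
    · rw [if_neg hj, hb]

theorem pi_postcomp_circleHom (f : Hom M Z) (k : Fin m)
    (a : HomotopyGroup (Fin (n + 1)) M M.point) :
    (f.postcomp X).pi n (circleHom A k a) = circleHom A k (f.pi (n + 1) a) := by
  obtain ⟨p, rfl⟩ := cls_surjective a
  rw [circleHom_cls, Hom.pi_cls, Hom.pi_cls, circleHom_cls]
  refine congrArg cls (GenLoop.ext _ _ fun s => nullMaps_ext_arc A fun j t => ?_)
  change f.toMap ((circleLoop A k p s).1 (A.arc j t)) = _
  rw [circleLoop_apply, circleLoop_apply]
  split_ifs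
  · rfl
  · exact f.map_point

/-- The point of the unit interval nearest to a real number. -/
noncomputable def clampI : C(ℝ, I) := ⟨Set.projIcc 0 1 zero_le_one, continuous_projIcc⟩

theorem clampI_of_nonpos {r : ℝ} (h : r ≤ 0) : clampI r = 0 := Set.projIcc_of_le_left zero_le_one h

theorem clampI_of_one_le {r : ℝ} (h : 1 ≤ r) : clampI r = 1 := Set.projIcc_of_right_le zero_le_one h

theorem clampI_coe (t : I) : clampI t = t := Set.projIcc_val zero_le_one t

/-- A null-homotopy of the circle loop may move the wedge point along a track. Going out along the
track, across the constant end and back along the same track is a deformation of `p` rel boundary;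
the remaining out-and-back path contracts. -/
theorem circleHom_injective (k : Fin m) :
    Function.Injective (circleHom A k (Z := Z) (n := n)) := by
  rw [injective_iff_map_eq_one]
  intro a ha
  obtain ⟨p, rfl⟩ := cls_surjective a
  rw [circleHom_cls, ← cls_const, cls_eq_iff] at ha
  obtain ⟨K⟩ := ha
  rw [← cls_const, cls_eq_iff]
  let H : C((I × (Fin n → I)) × I, Z) :=
    ⟨fun z => nullEval (K z.1, A.arc k z.2), by fun_prop⟩
  have H0 : ∀ s t, H ((0, s), t) = p (Fin.snoc s t : Fin (n + 1) → I) := fun s t => by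
    change (K (0, s)).1 (A.arc k t) = _
    rw [K.apply_zero]
    exact (circleLoop_apply A k p s k t).trans (if_pos rfl)
  have H1 : ∀ s t, H ((1, s), t) = Z.point := fun s t => by
    change (K (1, s)).1 (A.arc k t) = _
    rw [K.apply_one]
    rfl
  have Hb : ∀ r s t, s ∈ Cube.boundary (Fin n) → H ((r, s), t) = Z.point := fun r s t hs => by
    change (K (r, s)).1 (A.arc k t) = _
    rw [K.eq_fst r hs]
    change (circleLoop A k p s).1 _ = _
    exact congrArg (fun f : nullMaps X Z => f.1 (A.arc k t)) ((circleLoop A k p).2 s hs)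
  have He : ∀ r s t, t = 1 → H ((r, s), t) = H ((r, s), 0) := fun r s t ht => by
    change (K (r, s)).1 (A.arc k t) = (K (r, s)).1 (A.arc k 0)
    rw [ht, A.arc_one, A.arc_zero]
  have H00 : ∀ s, H ((0, s), 0) = Z.point := fun s => by
    rw [H0]
    exact p.2 _ (Cube.snoc_mem_boundary (Or.inr (Or.inl rfl)))
  -- `tent` rises on the first third, equals 1 on the middle third and falls on the last. `slide`
  -- deforms the identity into the map that moves only on the middle third.
  let tent : C(I, I) := ⟨fun u => clampI (min (3 * (u : ℝ)) (3 - 3 * u)), by fun_prop⟩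
  let slide : C(I × I, I) :=
    ⟨fun z => clampI ((1 - (z.1 : ℝ)) * z.2 + z.1 * clampI (3 * (z.2 : ℝ) - 1)), by fun_prop⟩
  have tent0 : tent 0 = 0 := clampI_of_nonpos (by simp)
  have tent1 : tent 1 = 0 := clampI_of_nonpos (by simp)
  have slide0 : ∀ r, slide (r, 0) = 0 := fun r => clampI_of_nonpos (by
    have : clampI (3 * ((0 : I) : ℝ) - 1) = 0 := clampI_of_nonpos (by simp)
    simp only [this]; simp)
  have slide1 : ∀ r, slide (r, 1) = 1 := fun r => clampI_of_one_le (by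
    have : clampI (3 * ((1 : I) : ℝ) - 1) = 1 := clampI_of_one_le (by norm_num)
    simp only [this]; simp)
  let Γ : C(I × (Fin (n + 1) → I), Z) :=
    ⟨fun z => H ((z.1 * tent (z.2 (Fin.last n)), Fin.init z.2), slide (z.1, z.2 (Fin.last n))), by
      have : Continuous fun z : I × (Fin (n + 1) → I) => (Fin.init z.2 : Fin n → I) :=
        Continuous.finInit (A := fun _ => I) continuous_snd
      fun_prop⟩
  let Δ : C(I × (Fin (n + 1) → I), Z) :=
    ⟨fun z => H ((σ z.1 * tent (z.2 (Fin.last n)), Fin.init z.2), 0), by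
      have : Continuous fun z : I × (Fin (n + 1) → I) => (Fin.init z.2 : Fin n → I) :=
        Continuous.finInit (A := fun _ => I) continuous_snd
      fun_prop⟩
  have hΓ : ∀ r w, w ∈ Cube.boundary (Fin (n + 1)) → Γ (r, w) = Z.point := fun r w hw => by
    change H ((r * tent (w (Fin.last n)), Fin.init w), slide (r, w (Fin.last n))) = _
    rcases Cube.boundary_succ hw with h | h | h
    · exact Hb _ _ _ h
    · rw [h, slide0, tent0, mul_zero, H00]
    · rw [h, slide1, tent1, mul_zero, He _ _ _ rfl, H00]
  have hΔ : ∀ r w, w ∈ Cube.boundary (Fin (n + 1)) → Δ (r, w) = Z.point := fun r w hw => by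
    change H ((σ r * tent (w (Fin.last n)), Fin.init w), 0) = _
    rcases Cube.boundary_succ hw with h | h | h
    · exact Hb _ _ _ h
    · rw [h, tent0, mul_zero, H00]
    · rw [h, tent1, mul_zero, H00]
  -- On the outer thirds the arc coordinate is an end, and both ends give the same value; on the
  -- middle third both sides lie in the constant end of `H`.
  have hΓΔ : ∀ w, Γ (1, w) = Δ (0, w) := fun w => by
    change H ((1 * tent (w (Fin.last n)), Fin.init w), slide (1, w (Fin.last n))) =
      H ((σ 0 * tent (w (Fin.last n)), Fin.init w), 0)
    rw [unitInterval.symm_zero, one_mul]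
    generalize w (Fin.last n) = t
    have hs : slide (1, t) = clampI (3 * (t : ℝ) - 1) := by
      change clampI ((1 - ((1 : I) : ℝ)) * t + ((1 : I) : ℝ) * clampI (3 * (t : ℝ) - 1)) = _
      rw [Set.Icc.coe_one, sub_self, zero_mul, zero_add, one_mul, clampI_coe]
    rw [hs]
    rcases le_total (3 * (t : ℝ)) 1 with h | h
    · rw [clampI_of_nonpos (by linarith)]
    · rcases le_total (3 * (t : ℝ)) 2 with h' | h'
      · have : tent t = 1 := clampI_of_one_le (le_min h (by linarith))
        rw [this, H1, H1]
      · exact He _ _ _ (clampI_of_one_le (by linarith))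
  refine GenLoop.Homotopic.trans (g := ⟨⟨fun w => Γ (1, w), by fun_prop⟩, fun w hw => hΓ 1 w hw⟩)
    ⟨⟨⟨Γ, fun w => ?_, fun w => rfl⟩, fun r w hw => ?_⟩⟩
    ⟨⟨⟨Δ, fun w => (hΓΔ w).symm, fun w => ?_⟩, fun r w hw => ?_⟩⟩
  · change H ((0 * tent (w (Fin.last n)), Fin.init w), slide (0, w (Fin.last n))) = p w
    have hs : slide (0, w (Fin.last n)) = w (Fin.last n) := by
      change clampI ((1 - ((0 : I) : ℝ)) * (w (Fin.last n) : ℝ) + ((0 : I) : ℝ) * _) = _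
      rw [Set.Icc.coe_zero, zero_mul, sub_zero, one_mul, add_zero, clampI_coe]
    rw [zero_mul, hs, H0, Fin.snoc_init_self]
  · exact (hΓ r w hw).trans (p.2 w hw).symm
  · change H ((σ 1 * tent (w (Fin.last n)), Fin.init w), 0) = Z.point
    rw [unitInterval.symm_one, zero_mul, H00]
  · exact (hΔ r w hw).trans (hΓ 1 w hw).symm

end BasedSpace

/-! ### Generation by constants and circles -/

namespace BasedSpace

variable {m : ℕ} {X : Type} [TopologicalSpace X] [LocallyCompactSpace X] [T2Space X]
  (A : ArcPresentation m X) {M Z : BasedSpace.{u}} {n : ℕ}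

/-- The restriction of a cubical loop of null maps to an arc. -/
def arcRestrict (p : GenLoop (Fin n) (nullMaps X Z) (nullMaps X Z).point) (k : Fin m) :
    C((Fin n → I) × I, Z) :=
  ⟨fun z => nullEval (p.1 z.1, A.arc k z.2), by fun_prop⟩

theorem arcRestrict_of_end {p : GenLoop (Fin n) (nullMaps X Z) (nullMaps X Z).point}
    (hp : ∀ s, (p s).1 A.base = Z.point) (k : Fin m) (s : Fin n → I) (t : I)
    (ht : t = 0 ∨ t = 1) : arcRestrict A p k (s, t) = Z.point := by
  change (p s).1 (A.arc k t) = _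
  rw [A.arc_of_end k ht, hp]

theorem arcRestrict_of_boundary (p : GenLoop (Fin n) (nullMaps X Z) (nullMaps X Z).point)
    (k : Fin m) (s : Fin n → I) (t : I) (hs : s ∈ Cube.boundary (Fin n)) :
    arcRestrict A p k (s, t) = Z.point :=
  congrArg (fun f : nullMaps X Z => f.1 (A.arc k t)) (p.2 s hs)

variable [NeZero n]

/-- A loop trivial at the wedge point is the pointwise product of its restrictions to the circles:
at each point at most one factor is not the unit. `cls_mulLoop` turns this into a product of
classes. -/
theorem cls_mem_iSup_range_circleHom (μ : UnitalMul M)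
    (p : GenLoop (Fin n) (nullMaps X M) (nullMaps X M).point)
    (hp : ∀ s, (p s).1 A.base = M.point) :
    cls p ∈ ⨆ k, (circleHom A k (Z := M) (n := n)).range := by
  classical
  let part : Finset (Fin m) → GenLoop (Fin n) (nullMaps X M) (nullMaps X M).point := fun S =>
    loopOfArcs A (fun k => if k ∈ S then arcRestrict A p k else ContinuousMap.const _ M.point)
      (fun k s t ht => by
        split_ifs
        · exact arcRestrict_of_end A hp k s t ht
        · rfl)
      (fun k s t hs => by
        split_ifs
        · exact arcRestrict_of_boundary A p k s t hs
        · rfl)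
  have part_apply : ∀ S s k t, (part S s).1 (A.arc k t) =
      if k ∈ S then (p s).1 (A.arc k t) else M.point := fun S s k t => by
    refine (loopOfArcs_apply A _ _ _ s k t).trans ?_
    split_ifs <;> rfl
  have key : ∀ S, cls (part S) ∈ ⨆ k, (circleHom A k (Z := M) (n := n)).range := by
    intro S
    induction S using Finset.induction_on with
    | empty =>
      have : part ∅ = GenLoop.const :=
        GenLoop.ext _ _ fun s => nullMaps_ext_arc A fun k t => by
          rw [part_apply]
          rfl
      rw [this, cls_const]
      exact one_mem _
    | insert k S hk ih =>
      let γ : GenLoop (Fin (n + 1)) M M.point :=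
        ⟨⟨fun w => arcRestrict A p k (Fin.init w, w (Fin.last n)), by
          have : Continuous fun w : Fin (n + 1) → I => (Fin.init w : Fin n → I) :=
            Continuous.finInit (A := fun _ => I) continuous_id
          fun_prop⟩, fun w hw => by
            rcases Cube.boundary_succ hw with h | h
            · exact arcRestrict_of_boundary A p k _ _ h
            · exact arcRestrict_of_end A hp k _ _ h⟩
      have hγ : ∀ s t, γ (Fin.snoc s t : Fin (n + 1) → I) = (p s).1 (A.arc k t) := fun s t => by
        change arcRestrict A p k (Fin.init (Fin.snoc s t : Fin (n + 1) → I),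
          (Fin.snoc s t : Fin (n + 1) → I) (Fin.last n)) = _
        rw [Fin.init_snoc, Fin.snoc_last]
        rfl
      have : part (insert k S) = (μ.pointwise X).mulLoop (circleLoop A k γ) (part S) :=
        GenLoop.ext _ _ fun s => nullMaps_ext_arc A fun l t => by
          change _ = μ.mul ((circleLoop A k γ s).1 (A.arc l t), (part S s).1 (A.arc l t))
          rw [part_apply, part_apply, circleLoop_apply, hγ]
          by_cases hl : l = k
          · subst hl
            rw [if_pos (Finset.mem_insert_self _ _), if_pos rfl, if_neg hk, μ.mul_point]
          · rw [if_neg hl, μ.point_mul]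
            simp only [Finset.mem_insert, hl, false_or]
      rw [this, UnitalMul.cls_mulLoop]
      exact mul_mem (Subgroup.mem_iSup_of_mem k ⟨cls γ, rfl⟩) ih
  have : part Finset.univ = p :=
    GenLoop.ext _ _ fun s => nullMaps_ext_arc A fun k t => by
      rw [part_apply, if_pos (Finset.mem_univ _)]
  rw [← this]
  exact key _

/-- Homotopy extension for the wedge point in `X`, done explicitly: collars growing at both ends of
every arc absorb the null-homotopy `h` of the values at the wedge point. -/
theorem exists_cls_eq_of_pi_evalHom_eq_one
    (x : HomotopyGroup (Fin n) (nullMaps X Z) (nullMaps X Z).point)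
    (hx : (evalHom A.base).pi n x = 1) : ∃ p, cls p = x ∧ ∀ s, (p s).1 A.base = Z.point := by
  obtain ⟨p, rfl⟩ := cls_surjective x
  rw [Hom.pi_cls, ← cls_const, cls_eq_iff] at hx
  obtain ⟨h⟩ := hx
  have h0 : ∀ s, h (0, s) = (p s).1 A.base := fun s => h.apply_zero s
  have h1 : ∀ s, h (1, s) = Z.point := fun s => h.apply_one s
  have hb : ∀ r s, s ∈ Cube.boundary (Fin n) → h (r, s) = Z.point := fun r s hs =>
    (h.eq_fst r hs).trans (congrArg (fun f : nullMaps X Z => f.1 A.base) (p.2 s hs))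
  -- At time r, `v` runs linearly from -r to 1 + r along the arc. Where it lies in [0, 1] the
  -- original map is used; outside, the excess `e` is the time at which `h` is read.
  let v : C((I × (Fin n → I)) × I, ℝ) :=
    ⟨fun z => (1 + 2 * (z.1.1 : ℝ)) * z.2 - z.1.1, by fun_prop⟩
  let e : C((I × (Fin n → I)) × I, ℝ) := ⟨fun z => max (-v z) (v z - 1), by fun_prop⟩
  let D : Fin m → C((I × (Fin n → I)) × I, Z) := fun k =>
    ⟨fun z => if e z ≤ 0 then arcRestrict A p k (z.1.2, clampI (v z)) else h (clampI (e z), z.1.2),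
      by
        -- Where `e` vanishes, `v` is 0 or 1, so both formulas give the value of `p` at the wedge
        -- point.
        refine Continuous.if_le (by fun_prop) (by fun_prop) e.continuous continuous_const ?_
        intro z hz
        rw [clampI_of_nonpos hz.le, h0]
        refine congrArg (p z.1.2).1 (A.arc_of_end k ?_)
        rcases max_choice (-v z) (v z - 1) with h | h
        · exact Or.inl (clampI_of_nonpos (by linarith [h.symm.trans hz]))
        · exact Or.inr (clampI_of_one_le (by linarith [h.symm.trans hz]))⟩
  have D_start : ∀ k s t, D k ((0, s), t) = (p s).1 (A.arc k t) := fun k s t => by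
    have hv : v ((0, s), t) = t := by simp [v]
    have he : e ((0, s), t) ≤ 0 := by
      change max (-v ((0, s), t)) (v ((0, s), t) - 1) ≤ 0
      rw [hv]
      exact max_le (by linarith [t.2.1]) (by linarith [t.2.2])
    refine (if_pos he).trans ?_
    rw [hv, clampI_coe]
    rfl
  have D_end : ∀ k s t, t = 0 ∨ t = 1 → D k (s, t) = h s := fun k s t ht => by
    have hs := s.1.2.1
    have he : e (s, t) = s.1 := by
      change max (-((1 + 2 * (s.1 : ℝ)) * t - s.1)) ((1 + 2 * (s.1 : ℝ)) * t - s.1 - 1) = s.1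
      rcases ht with rfl | rfl
      · rw [Set.Icc.coe_zero, max_eq_left] <;> linarith
      · rw [Set.Icc.coe_one, max_eq_right] <;> linarith
    change ite (e (s, t) ≤ 0) (arcRestrict A p k (s.2, clampI (v (s, t))))
      (h (clampI (e (s, t)), s.2)) = _
    rw [he, clampI_coe]
    split_ifs with h'
    · have hs0 : s.1 = 0 := Subtype.ext (le_antisymm h' hs)
      have hv : v (s, t) = t := by simp [v, hs0]
      rw [hv, clampI_coe]
      change (p s.2).1 (A.arc k t) = h (s.1, s.2)
      rw [hs0, A.arc_of_end k ht, h0]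
    · rfl
  have D_boundary : ∀ k r s t, s ∈ Cube.boundary (Fin n) → D k ((r, s), t) = Z.point :=
    fun k r s t hs => by
      change ite _ (arcRestrict A p k (s, _)) (h (_, s)) = _
      split_ifs
      · exact arcRestrict_of_boundary A p k _ _ hs
      · exact hb _ _ hs
  let q := loopOfArcs A (fun k => ⟨fun z => D k ((1, z.1), z.2), by fun_prop⟩)
    (fun k s t ht => (D_end k (1, s) t ht).trans (h1 s))
    (fun k s t hs => D_boundary k 1 s t hs)
  have hq : ∀ s k t, (q s).1 (A.arc k t) = D k ((1, s), t) := fun s k t =>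
    loopOfArcs_apply A _ _ _ s k t
  refine ⟨q, (cls_eq_iff.2 ?_).symm, fun s => ?_⟩
  · exact homotopic_of_arcs A p q D h D_end D_start (fun k s t => (hq s k t).symm) D_boundary
  · obtain ⟨k, t, hk⟩ := A.exists_arc A.base
    rw [← A.arc_zero k, hq, D_end k _ _ (Or.inl rfl), h1]

/-- The homotopy groups of the null maps from a bouquet to a space with a unital multiplication
are generated by constant maps and by the individual circles. -/
theorem mem_range_constHom_sup_range_circleHom [PathConnectedSpace M] (μ : UnitalMul M)
    (x : HomotopyGroup (Fin n) (nullMaps X M) (nullMaps X M).point) :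
    x ∈ ((constHom X M).pi n).range ⊔ ⨆ k, (circleHom A k (Z := M) (n := n)).range := by
  -- Constant maps split evaluation, so dividing by `c` leaves a class in the kernel of evaluation.
  let c := (constHom X M).pi n ((evalHom A.base).pi n x)
  have hc : (evalHom A.base).pi n (x * c⁻¹) = 1 := by
    rw [map_mul, map_inv, pi_evalHom_constHom, mul_inv_cancel]
  obtain ⟨p, hp, hp'⟩ := exists_cls_eq_of_pi_evalHom_eq_one A _ hc
  have h1 := cls_mem_iSup_range_circleHom A μ p hp'
  rw [hp] at h1
  rw [← inv_mul_cancel_right x c]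
  exact mul_mem (Subgroup.mem_sup_right h1) (Subgroup.mem_sup_left ⟨_, rfl⟩)

end BasedSpace

/-! ### Splitting the image group -/

/-- The detection is triangular: `r k` need not kill the image of `c`, so `f` first removes the
`A`-component and then each `r k` isolates one remaining component. -/
theorem nonempty_mulEquiv_prod_pi {ι E A B F F' : Type*} [Fintype ι] [DecidableEq ι] [CommGroup E]
    [Group A] [Group B] [Group F] [Group F'] (c : A →* E) (i : ι → B →* E) (f : E →* F)
    (r : ι → E →* F') (hfi : ∀ k b, f (i k b) = 1) (hfc : ∀ a, f (c a) = 1 → a = 1)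
    (hri : ∀ k l b, l ≠ k → r k (i l b) = 1) (hr : ∀ k b, r k (i k b) = 1 → b = 1)
    (hgen : c.range ⊔ ⨆ k, (i k).range = ⊤) : Nonempty (E ≃* A × (ι → B)) := by
  let Ψ : A × (ι → B) →* E := MonoidHom.mk' (fun z => c z.1 * ∏ k, i k (z.2 k)) fun z w => by
    simp only [Prod.fst_mul, Prod.snd_mul, Pi.mul_apply, map_mul, Finset.prod_mul_distrib]
    exact mul_mul_mul_comm _ _ _ _
  have hΨ : ∀ a b, Ψ (a, b) = c a * ∏ k, i k (b k) := fun _ _ => rfl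
  have inj : Function.Injective Ψ := by
    rw [injective_iff_map_eq_one]
    rintro ⟨a, b⟩ h
    rw [hΨ] at h
    have hprod : f (∏ k, i k (b k)) = 1 :=
      MonoidHom.mem_ker.1 (Subgroup.prod_mem _ fun k _ => MonoidHom.mem_ker.2 (hfi k _))
    have ha : a = 1 := hfc a (by
      have := congrArg f h
      rwa [map_mul, hprod, mul_one, map_one] at this)
    rw [ha, map_one, one_mul] at h
    refine Prod.ext ha (funext fun k => hr k _ ?_)
    have h2 : r k (∏ l ∈ Finset.univ.erase k, i l (b l)) = 1 :=
      MonoidHom.mem_ker.1 (Subgroup.prod_mem _ fun l hl =>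
        MonoidHom.mem_ker.2 (hri k l _ (Finset.ne_of_mem_erase hl)))
    have h3 := congrArg (r k) h
    rwa [← Finset.mul_prod_erase _ _ (Finset.mem_univ k), map_mul, h2, mul_one, map_one] at h3
  have surj : Function.Surjective Ψ := by
    rw [← MonoidHom.range_eq_top, eq_top_iff, ← hgen]
    refine sup_le ?_ (iSup_le fun k => ?_)
    · rintro _ ⟨a, rfl⟩
      exact ⟨(a, 1), by simp [hΨ]⟩
    · rintro _ ⟨b, rfl⟩
      refine ⟨(1, Pi.mulSingle k b), ?_⟩
      rw [hΨ, map_one, one_mul, Finset.prod_eq_single k]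
      · rw [Pi.mulSingle_eq_same]
      · intro l _ hl
        rw [Pi.mulSingle_eq_of_ne hl, map_one]
      · exact fun h => (h (Finset.mem_univ k)).elim
  exact ⟨(MulEquiv.ofBijective Ψ ⟨inj, surj⟩).symm⟩

namespace BasedSpace

variable {m : ℕ} {X : Type} [TopologicalSpace X] [LocallyCompactSpace X] [T2Space X]

/-- Evaluation at the wedge point detects the constant part and the collapses detect the circles,
both in `Z`. Generation and commutativity are inherited from `M`. -/
theorem nonempty_image_postcomp_mulEquiv (A : ArcPresentation m X) {M Z : BasedSpace.{u}}
    [PathConnectedSpace M] [PathConnectedSpace Z] (μ : UnitalMul M) (f : Hom M Z) (n : ℕ)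
    [NeZero n] :
    Nonempty ((f.postcomp X).image n ≃* f.image n × (Fin m → f.image (n + 1))) := by
  let _ : CommGroup ((f.postcomp X).image n) :=
    { (inferInstance : Group ((f.postcomp X).image n)) with
      mul_comm := (μ.pointwise X).image_mul_comm _ }
  let c : f.image n →* (f.postcomp X).image n :=
    (((constHom X Z).pi n).comp (f.image n).subtype).codRestrict _ (by
      rintro ⟨_, a, rfl⟩
      exact ⟨_, pi_postcomp_constHom f a⟩)
  let i : Fin m → f.image (n + 1) →* (f.postcomp X).image n := fun k =>
    ((circleHom A k).comp (f.image (n + 1)).subtype).codRestrict _ (by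
      rintro ⟨_, a, rfl⟩
      exact ⟨_, pi_postcomp_circleHom A f k a⟩)
  refine nonempty_mulEquiv_prod_pi c i
    (((evalHom A.base).pi n).comp ((f.postcomp X).image n).subtype)
    (fun k => ((precompHom (A.collapse k)).pi n).comp ((f.postcomp X).image n).subtype)
    (fun k b => pi_evalHom_circleHom A k b.1) (fun a ha => ?_) (fun k l b hlk => ?_)
    (fun k b hb => ?_) ?_
  · exact Subtype.ext ((pi_evalHom_constHom A.base a.1).symm.trans ha)
  · exact (pi_precompHom_circleHom A k l b.1).trans (if_neg hlk)
  · refine Subtype.ext (circleHom_injective A k ?_)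
    rw [Subgroup.coe_one, map_one]
    exact ((pi_precompHom_circleHom A k k b.1).trans (if_pos rfl)).symm.trans hb
  · rw [eq_top_iff]
    rintro ⟨_, x, rfl⟩ -
    let T := c.range ⊔ ⨆ k, (i k).range
    -- By naturality in `f`, generators upstairs map to generators of the image.
    have : ((constHom X M).pi n).range ⊔ ⨆ k, (circleHom A k (Z := M) (n := n)).range ≤
        T.comap ((f.postcomp X).pi n).rangeRestrict := by
      refine sup_le ?_ (iSup_le fun k => ?_)
      · rintro _ ⟨a, rfl⟩
        refine Subgroup.mem_sup_left ⟨⟨_, a, rfl⟩, Subtype.ext ?_⟩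
        exact (pi_postcomp_constHom f a).symm
      · rintro _ ⟨a, rfl⟩
        refine Subgroup.mem_sup_right (Subgroup.mem_iSup_of_mem k ⟨⟨_, a, rfl⟩, Subtype.ext ?_⟩)
        exact (pi_postcomp_circleHom A f k a).symm
    exact this (mem_range_constHom_sup_range_circleHom A μ x)

end BasedSpace

/-! ### Counting cells by degree -/

/-- The cells of the `N`-fold power of a bouquet of `m` circles. -/
def CellIndex (m : ℕ) : ℕ → Type
  | 0 => Unit
  | N + 1 => CellIndex m N ⊕ (Fin m × CellIndex m N)

namespace CellIndex

instance instFintype (m : ℕ) : ∀ N, Fintype (CellIndex m N)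
  | 0 => inferInstanceAs (Fintype Unit)
  | N + 1 =>
    let _ := instFintype m N
    inferInstanceAs (Fintype (CellIndex m N ⊕ (Fin m × CellIndex m N)))

/-- The dimension of a cell. -/
def deg {m : ℕ} : ∀ {N : ℕ}, CellIndex m N → ℕ
  | 0, _ => 0
  | _ + 1, Sum.inl i => deg i
  | _ + 1, Sum.inr (_, i) => deg i + 1

theorem deg_lt {m : ℕ} : ∀ {N : ℕ} (i : CellIndex m N), deg i < N + 1
  | 0, _ => Nat.one_pos
  | N + 1, Sum.inl i => (deg_lt (N := N) i).trans (Nat.lt_succ_self _)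
  | N + 1, Sum.inr (_, i) => Nat.succ_lt_succ (deg_lt (N := N) i)

/-- Pascal's rule: a new cell is an old one of the same degree, or one of `m` copies of an old one
with degree raised by one. -/
theorem sum_deg_eq (m N : ℕ) : ∀ j : ℕ,
    (∑ i : CellIndex m N, if deg i = j then 1 else 0) = m ^ j * N.choose j := by
  induction N with
  | zero =>
    intro j
    refine (Fintype.sum_unique (ι := Unit) (fun _ => if 0 = j then 1 else 0)).trans ?_
    cases j <;> simp
  | succ N ih =>
    intro j
    refine (Fintype.sum_sum_type (α₁ := CellIndex m N) (α₂ := Fin m × CellIndex m N)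
      (fun i => if deg (N := N + 1) i = j then 1 else 0)).trans ?_
    rw [Fintype.sum_prod_type]
    change (∑ i : CellIndex m N, if deg i = j then 1 else 0) +
      ∑ _ : Fin m, ∑ i : CellIndex m N, (if deg i + 1 = j then 1 else 0) = _
    rw [ih]
    cases j with
    | zero => simp
    | succ j =>
      simp only [Nat.add_right_cancel_iff, ih, Finset.sum_const, Finset.card_univ, Fintype.card_fin,
        smul_eq_mul, Nat.choose_succ_succ]
      ring

theorem exists_equiv_sigma (m N : ℕ) :
    ∃ e : CellIndex m N ≃ Σ j : Fin (N + 1), Fin (m ^ (j : ℕ) * N.choose j),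
      ∀ x, deg (e.symm x) = x.1 := by
  classical
  let d : CellIndex m N → Fin (N + 1) := fun i => ⟨deg i, deg_lt i⟩
  have hcard : ∀ j, Fintype.card {i // d i = j} = m ^ (j : ℕ) * N.choose j := fun j => by
    rw [← sum_deg_eq m N j, Fintype.card_subtype, Finset.card_filter]
    simp only [d, Fin.ext_iff]
  refine ⟨(Equiv.sigmaFiberEquiv d).symm.trans
    (Equiv.sigmaCongrRight fun j => Fintype.equivFinOfCardEq (hcard j)), fun x => ?_⟩
  exact congrArg Fin.val ((Fintype.equivFinOfCardEq (hcard x.1)).symm x.2).2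

end CellIndex

/-- Splitting a product indexed by `α ⊕ (κ × α)`. -/
def MulEquiv.prodPiEquivPiSum {α κ : Type*} {F : α ⊕ (κ × α) → Type*} [∀ i, Group (F i)] :
    ((∀ a, F (Sum.inl a)) × (∀ k a, F (Sum.inr (k, a)))) ≃* ∀ i, F i where
  toFun g
    | Sum.inl a => g.1 a
    | Sum.inr (k, a) => g.2 k a
  invFun h := (fun a => h (Sum.inl a), fun k a => h (Sum.inr (k, a)))
  left_inv _ := rfl
  right_inv h := by
    funext i
    rcases i with a | ⟨k, a⟩ <;> rfl
  map_mul' g h := by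
    funext i
    rcases i with a | ⟨k, a⟩ <;> rfl

theorem nonempty_pi_mulEquiv_of_degree {α β : Type*} (e : α ≃ β) {d : α → ℕ} {d' : β → ℕ}
    (h : ∀ b, d (e.symm b) = d' b) (H : ℕ → Type*) [∀ k, Group (H k)] :
    Nonempty ((∀ a, H (d a)) ≃* ∀ b, H (d' b)) := by
  obtain rfl : (fun b => d (e.symm b)) = d' := funext h
  exact ⟨{ Equiv.piCongrLeft' (fun a => H (d a)) e with map_mul' := fun _ _ => rfl }⟩

/-- Splitting a product indexed by a sigma type. -/
def MulEquiv.piSigma {ι : Type*} {κ : ι → Type*} (F : (i : ι) → κ i → Type*)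
    [∀ i k, Group (F i k)] : (∀ x : Σ i, κ i, F x.1 x.2) ≃* ∀ i k, F i k where
  toFun g i k := g ⟨i, k⟩
  invFun g x := g x.1 x.2
  left_inv _ := rfl
  right_inv _ := rfl
  map_mul' _ _ := rfl

/-! ### Iterating the splitting -/

namespace BasedSpace

variable {m : ℕ} {X : Type} [TopologicalSpace X] [LocallyCompactSpace X] [T2Space X]

/-- Image groups in equal degrees are isomorphic. -/
noncomputable def imageCongr {M Z : BasedSpace.{u}} (f : Hom M Z) {a b : ℕ} [NeZero a] [NeZero b]
    (h : a = b) : f.image a ≃* f.image b := by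
  subst h
  exact MulEquiv.refl _

/-- The inductive step needs the splitting in degrees `n` and `n + 1`, hence the quantification over
`n` inside the induction. -/
theorem nonempty_image_iter_mulEquiv_cells (A : ArcPresentation m X) {M Z : BasedSpace.{u}}
    [PathConnectedSpace M] [PathConnectedSpace Z] (μ : UnitalMul M) (f : Hom M Z) (N : ℕ) :
    ∀ (n : ℕ) [NeZero n],
    Nonempty ((f.iter X N).image n ≃* ∀ i : CellIndex m N, f.image (n + i.deg)) := by
  induction N with
  | zero =>
    intro n _
    exact ⟨(MulEquiv.piUnique (ι := Unit) fun _ => f.image n).symm⟩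
  | succ N ih =>
    intro n _
    obtain ⟨e⟩ := nonempty_image_postcomp_mulEquiv A (μ.iter X N) (f.iter X N) n
    obtain ⟨e₀⟩ := ih n
    obtain ⟨e₁⟩ := ih (n + 1)
    let e₂ : (∀ i : CellIndex m N, f.image (n + 1 + i.deg)) ≃*
        ∀ i : CellIndex m N, f.image (n + (i.deg + 1)) :=
      MulEquiv.piCongrRight fun i => imageCongr f (by omega)
    exact ⟨(e.trans (MulEquiv.prodCongr e₀ (MulEquiv.piCongrRight fun _ => e₁.trans e₂))).trans
      (MulEquiv.prodPiEquivPiSum (F := fun i : CellIndex m N ⊕ (Fin m × CellIndex m N) =>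
        f.image (n + CellIndex.deg (N := N + 1) i)))⟩

theorem nonempty_image_iter_mulEquiv (A : ArcPresentation m X) {M Z : BasedSpace.{u}}
    [PathConnectedSpace M] [PathConnectedSpace Z] (μ : UnitalMul M) (f : Hom M Z) (N n : ℕ)
    [NeZero n] : Nonempty ((f.iter X N).image n ≃*
      ((j : Fin (N + 1)) → Fin (m ^ (j : ℕ) * N.choose j) → f.image (n + j))) := by
  obtain ⟨e₁⟩ := nonempty_image_iter_mulEquiv_cells A μ f N n
  obtain ⟨e, he⟩ := CellIndex.exists_equiv_sigma m N
  obtain ⟨e₂⟩ := nonempty_pi_mulEquiv_of_degree (d := CellIndex.deg) (d' := fun x => (x.1 : ℕ)) e he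
    (fun k => f.image (n + k))
  exact ⟨(e₁.trans e₂).trans (MulEquiv.piSigma fun (j : Fin (N + 1))
    (_ : Fin (m ^ (j : ℕ) * N.choose j)) => f.image (n + j))⟩

theorem nonempty_gottliebGroup_iterNullMaps_mulEquiv [PathConnectedSpace X]
    (A : ArcPresentation m X) (Y : BasedSpace.{u}) [PathConnectedSpace Y] [LocallyCompactSpace Y]
    (N n : ℕ) [NeZero n] : Nonempty ((iterNullMaps X Y N).gottliebGroup n ≃*
      ((j : Fin (N + 1)) → Fin (m ^ (j : ℕ) * N.choose j) → Y.gottliebGroup (n + j))) := by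
  rw [gottliebGroup_iterNullMaps]
  exact nonempty_image_iter_mulEquiv A (UnitalMul.aut₁ Y) Y.omegaHom N n

end BasedSpace

/-! ### The circle and the bouquet as arc presentations; conclusion -/

/-- The standard parametrization of the circle by the unit interval. -/
noncomputable def circleArc : C(I, Circle) := ⟨fun t => Circle.exp (2 * Real.pi * t), by fun_prop⟩

theorem circleArc_zero : circleArc 0 = 1 := by simp [circleArc]

theorem circleArc_one : circleArc 1 = 1 := by simp [circleArc]

theorem circleArc_eq {t u : I} (h : circleArc t = circleArc u) :
    t = u ∨ ((t = 0 ∨ t = 1) ∧ (u = 0 ∨ u = 1)) := by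
  obtain ⟨k, hk⟩ := Circle.exp_eq_exp.1 h
  have hk' : (t : ℝ) = u + k := by
    have := Real.pi_pos
    field_simp at hk
    linarith
  have ht := t.2
  have hu := u.2
  have h1 : (k : ℝ) < 2 := by linarith [ht.2, hu.1]
  have h2 : (-2 : ℝ) < k := by linarith [ht.1, hu.2]
  have h1' : k < 2 := by exact_mod_cast h1
  have h2' : -2 < k := by exact_mod_cast h2
  obtain rfl | rfl | rfl : k = -1 ∨ k = 0 ∨ k = 1 := by omega
  · push_cast at hk'
    exact Or.inr ⟨Or.inl (Subtype.ext (by linarith [ht.1, hu.2] : (t : ℝ) = 0)),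
      Or.inr (Subtype.ext (by linarith [ht.1, hu.2] : (u : ℝ) = 1))⟩
  · exact Or.inl (Subtype.ext (by simpa using hk'))
  · push_cast at hk'
    exact Or.inr ⟨Or.inr (Subtype.ext (by linarith [ht.2, hu.1] : (t : ℝ) = 1)),
      Or.inl (Subtype.ext (by linarith [ht.2, hu.1] : (u : ℝ) = 0))⟩

theorem circleArc_eq_one {t : I} (h : circleArc t = 1) : t = 0 ∨ t = 1 := by
  rcases circleArc_eq (h.trans circleArc_zero.symm) with h | h
  · exact Or.inl h
  · exact h.1

theorem circleArc_surjective : Function.Surjective circleArc := by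
  intro z
  obtain ⟨r, rfl⟩ := Circle.exp_surjective z
  have hpi := Real.two_pi_pos
  refine ⟨⟨Int.fract (r / (2 * Real.pi)), Int.fract_nonneg _, (Int.fract_lt_one _).le⟩, ?_⟩
  refine Circle.exp_eq_exp.2 ⟨-⌊r / (2 * Real.pi)⌋, ?_⟩
  change 2 * Real.pi * Int.fract (r / (2 * Real.pi)) = _
  rw [Int.fract]
  push_cast
  field_simp
  ring

/-- The circle as a bouquet of one circle. -/
noncomputable def ArcPresentation.circle : ArcPresentation 1 Circle where
  base := 1
  arc _ := circleArc
  arc_zero _ := circleArc_zero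
  arc_one _ := circleArc_one
  exists_arc x := ⟨0, circleArc_surjective x⟩
  arc_eq _ _ _ _ h := (circleArc_eq h).imp_left fun h => ⟨Subsingleton.elim _ _, h⟩

/-- The bouquet of `m` circles. -/
noncomputable def ArcPresentation.bouquet (m : ℕ) (k₀ : Fin m) : ArcPresentation m (Bouquet m) where
  base := Quotient.mk _ (k₀, 1)
  arc k := ⟨fun t => Quotient.mk _ (k, circleArc t),
    continuous_quotient_mk'.comp (continuous_const.prodMk circleArc.continuous)⟩
  arc_zero _ := Quotient.sound (Or.inr ⟨circleArc_zero, rfl⟩)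
  arc_one _ := Quotient.sound (Or.inr ⟨circleArc_one, rfl⟩)
  exists_arc x := by
    induction x using Quotient.inductionOn with | _ x
    obtain ⟨k, z⟩ := x
    obtain ⟨t, rfl⟩ := circleArc_surjective z
    exact ⟨k, t, rfl⟩
  arc_eq k t l u h := by
    rcases Quotient.exact h with h | ⟨h1, h2⟩
    · obtain ⟨rfl, h⟩ := Prod.ext_iff.1 h
      exact (circleArc_eq h).imp_left fun h => ⟨rfl, h⟩
    · exact Or.inr ⟨circleArc_eq_one h1, circleArc_eq_one h2⟩

theorem ArcPresentation.pathConnectedSpace {m : ℕ} {X : Type} [TopologicalSpace X]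
    (A : ArcPresentation m X) : PathConnectedSpace X := by
  have key : ∀ x, Joined x A.base := fun x => by
    obtain ⟨k, t, rfl⟩ := A.exists_arc x
    rw [← A.arc_zero k]
    exact (PathConnectedSpace.joined t 0).map (A.arc k).continuous
  exact ⟨⟨A.base⟩, fun x y => (key x).trans (key y).symm⟩

/-- The projections onto the single circles embed the bouquet continuously and injectively in a
torus. -/
instance (m : ℕ) : T2Space (Bouquet m) := by
  let f : Bouquet m → Fin m → Circle :=
    Quotient.lift (fun p l => if p.1 = l then p.2 else 1) (by
      rintro p q (rfl | ⟨h1, h2⟩)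
      · rfl
      · simp [h1, h2])
  have hf : Continuous f := by
    refine continuous_quot_lift _ (continuous_pi fun l => ?_)
    refine continuous_prod_of_discrete_left.2 fun k => ?_
    by_cases h : k = l
    · simpa [h] using continuous_id'
    · simpa [h] using continuous_const
  refine T2Space.of_injective_continuous (f := f) (fun x y h => ?_) hf
  induction x using Quotient.inductionOn with | _ x
  induction y using Quotient.inductionOn with | _ y
  have h' : ∀ l, (if x.1 = l then x.2 else 1) = if y.1 = l then y.2 else 1 := congrFun h
  refine Quotient.sound ?_
  by_cases hxy : x.1 = y.1
  · refine Or.inl (Prod.ext hxy ?_)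
    simpa [hxy] using h' y.1
  · refine Or.inr ⟨?_, ?_⟩
    · simpa [Ne.symm hxy] using h' x.1
    · simpa [hxy] using (h' y.1).symm

theorem mainTheorem4 (Y : BasedSpace.{u}) [PathConnectedSpace Y] [LocallyCompactSpace Y]
    [T2Space Y] :
    (∀ (k : ℕ) [NeZero k] (a b : Y.gottliebGroup k), a * b = b * a) ∧
    (∀ (m N n : ℕ) [NeZero n], 1 ≤ m → 1 ≤ N →
      Nonempty ((Y.iterFreeBouquet m N).gottliebGroup n ≃*
        ((j : Fin (N + 1)) → Fin (m ^ (j : ℕ) * N.choose j) → Y.gottliebGroup (n + j)))) ∧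
    (∀ (N n : ℕ) [NeZero n], 1 ≤ N →
      Nonempty ((Y.iterFreeLoop N).gottliebGroup n ≃*
        ((j : Fin (N + 1)) → Fin (N.choose j) → Y.gottliebGroup (n + j)))) := by
  refine ⟨fun k _ => (BasedSpace.UnitalMul.aut₁ Y).image_mul_comm Y.omegaHom, ?_, ?_⟩
  · intro m N n _ hm _
    -- Here m ≥ 1 supplies the wedge point; for m = 0 the quotient would be empty.
    let A := ArcPresentation.bouquet m ⟨0, hm⟩
    have := A.pathConnectedSpace
    exact BasedSpace.nonempty_gottliebGroup_iterNullMaps_mulEquiv A Y N n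
  · intro N n _ _
    obtain ⟨e⟩ :=
      BasedSpace.nonempty_gottliebGroup_iterNullMaps_mulEquiv ArcPresentation.circle Y N n
    exact ⟨e.trans (MulEquiv.piCongrRight fun j =>
      MulEquiv.arrowCongr (finCongr (by rw [one_pow, one_mul])) (MulEquiv.refl _))⟩
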